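/- Conventions. A tree $T$ is a nonempty connected graph without cycles; it need not be locally finite or countable. Let $d$ denote the combinatorial distance on its vertices. A ray in $T$ is a sequence of vertices $(x_n)_{n\in\mathbf N}$ with $d(x_m,x_n)=|m-n|$ for all $m,n\in\mathbf N$; it is pending if $x_n$ has degree $2$ in $T$ for all $n$ large enough. Two rays $(x_n)$ and $(y_n)$ are cofinal if there is $k\in\mathbf Z$ with $y_n=x_{n+k}$ for all $n$ large enough. The boundary $\partial T$ is the set of cofinality classes of rays, with the shadow topology, i.e. the topology generated by the shadows $(\partial T)_e$ of the oriented edges $e$ of $T$; for $e$ with source $s$ and terminus $t$, the shadow $(\partial T)_e$ consists of the classes represented by rays $(x_n)$ with $d(t,x_n)<d(s,x_n)$ for all $n$ large enough. A group $\Delta$ is a Powers group if $\Delta\neq\{1\}$ and, for every finite subset $F\subset\Delta\smallsetminus\{1\}$ and every integer $N\ge 1$, there exist a partition $\Delta=C\sqcup D$ and elements $\gamma_1,\dots,\gamma_N\in\Delta$ such that $fC\cap C=\emptyset$ for all $f\in F$ and $\gamma_jD\cap\gamma_kD=\emptyset$ for all $j,k\in\{1,\dots,N\}$ with $j\ne k$.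 A subgroup $H$ of a group $G$ is subnormal if there is a finite chain of subgroups $H=H_0\le H_1\le\dots\le H_k=G$ with $H_{j-1}$ normal in $H_j$ for $j=1,\dots,k$. A group is a strongly Powers group if each of its subnormal subgroups other than $\{1\}$ is a Powers group. Proposition 1.2. Let $T$ be a tree without vertices of degree $\le 1$ and without pending rays, and let $\Gamma$ be a countable group acting on $T$ by graph automorphisms. Assume that the action is - minimal: there is no proper $\Gamma$-invariant subtree (subtrees being nonempty); - without fixed boundary point: no point of $\partial T$ is fixed by all of $\Gamma$; - slender: for every $\gamma\in\Gamma$ with $\gamma\ne1$, the fixed-point set of $\gamma$ in $\partial T$ has empty interior. Then $\Gamma$ is a strongly Powers group. -/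

import Mathlib

/-- A ray in a graph: the enumeration `x 0, x 1, …` of its vertices, with `d(x m, x n) = |m - n|`. -/
structure Ray {V : Type*} (T : SimpleGraph V) where
  vert : ℕ → V
  dist_eq : ∀ m n : ℕ, (T.dist (vert m) (vert n) : ℤ) = |(m : ℤ) - (n : ℤ)|

/-- Two rays are cofinal if one is a shift of the other far enough along:
`y n = x (n + k)` for all large `n`, for some integer `k`. -/
def Ray.Cofinal {V : Type*} {T : SimpleGraph V} (x y : Ray T) : Prop :=
  ∃ k : ℤ, ∃ n₀ : ℕ, ∀ n m : ℕ, n₀ ≤ n → (m : ℤ) = (n : ℤ) + k → y.vert n = x.vert m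

theorem Ray.Cofinal.equivalence {V : Type*} (T : SimpleGraph V) :
    Equivalence (Ray.Cofinal (T := T)) where
  refl x := ⟨0, 0, fun n m _ h => by
    have h2 : m = n := by omega
    rw [h2]⟩
  symm := by
    rintro x y ⟨k, n₀, h⟩
    refine ⟨-k, n₀ + k.natAbs, fun n m hn hm => (h m n (by omega) (by omega)).symm⟩
  trans := by
    rintro x y z ⟨k, n₀, h⟩ ⟨l, n₁, h'⟩
    refine ⟨k + l, n₁ + n₀ + l.natAbs, fun n m hn hm => ?_⟩
    have hp : ((n + l : ℤ).toNat : ℤ) = n + l := by omega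
    rw [h' n (n + l : ℤ).toNat (by omega) hp]
    exact h _ m (by omega) (by omega)

/-- Cofinality, as a setoid on rays. -/
def raySetoid {V : Type*} (T : SimpleGraph V) : Setoid (Ray T) where
  r := Ray.Cofinal
  iseqv := Ray.Cofinal.equivalence T

/-- The boundary `∂T`: cofinality classes of rays. -/
def TreeBoundary {V : Type*} (T : SimpleGraph V) : Type _ := Quotient (raySetoid T)

/-- The boundary point represented by a ray. -/
def Ray.toBoundary {V : Type*} {T : SimpleGraph V} (x : Ray T) : TreeBoundary T :=
  Quotient.mk (raySetoid T) x

/-- The shadow of an oriented edge `e` (with source `e.fst` and terminus `e.snd`): the boundary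
points represented by rays which are eventually nearer to the terminus than to the source. -/
def shadow {V : Type*} (T : SimpleGraph V) (e : T.Dart) : Set (TreeBoundary T) :=
  {ξ | ∃ x : Ray T, x.toBoundary = ξ ∧
    ∃ n₀ : ℕ, ∀ n : ℕ, n₀ ≤ n → T.dist e.snd (x.vert n) < T.dist e.fst (x.vert n)}

/-- The shadow topology, generated by all shadows. -/
instance shadowTopology {V : Type*} (T : SimpleGraph V) : TopologicalSpace (TreeBoundary T) :=
  TopologicalSpace.generateFrom (Set.range (shadow T))

/-- A ray is pending if all but finitely many of its vertices have degree `2` in `T`. -/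
def Ray.IsPending {V : Type*} {T : SimpleGraph V} (x : Ray T) : Prop :=
  ∃ n₀ : ℕ, ∀ n : ℕ, n₀ ≤ n → (T.neighborSet (x.vert n)).encard = 2

theorem dist_map_automorphism {V : Type*} {T : SimpleGraph V} (φ : T ≃g T) (u v : V) :
    T.dist (φ u) (φ v) = T.dist u v := by
  have key : ∀ (ψ : T ≃g T) (a b : V), T.edist (ψ a) (ψ b) ≤ T.edist a b := by
    intro ψ a b
    refine le_iInf fun w => ?_
    have h := SimpleGraph.edist_le (w.map ψ.toHom)
    rw [SimpleGraph.Walk.length_map] at h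
    exact h
  have h2 := key φ.symm (φ u) (φ v)
  rw [RelIso.symm_apply_apply, RelIso.symm_apply_apply] at h2
  exact congrArg ENat.toNat (le_antisymm (key φ u v) h2)

/-- The image of a ray under an automorphism of the tree. -/
def Ray.map {V : Type*} {T : SimpleGraph V} (φ : T ≃g T) (x : Ray T) : Ray T where
  vert n := φ (x.vert n)
  dist_eq m n := by rw [dist_map_automorphism, x.dist_eq]

/-- The transformation of `∂T` induced by an automorphism of `T`. -/
def boundaryMap {V : Type*} {T : SimpleGraph V} (φ : T ≃g T) : TreeBoundary T → TreeBoundary T :=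
  Quotient.map (Ray.map φ) (by
    rintro x y ⟨k, n₀, h⟩
    exact ⟨k, n₀, fun n m hn hm => congrArg φ (h n m hn hm)⟩)

/-- An automorphism of `T` is slender if its fixed-point set in `∂T` has empty interior. -/
def IsSlender {V : Type*} {T : SimpleGraph V} (φ : T ≃g T) : Prop :=
  interior {ξ : TreeBoundary T | boundaryMap φ ξ = ξ} = ∅

/-- An action by automorphisms on `T` is slender if every nontrivial element is slender. -/
def IsSlenderAction {Γ V : Type*} [Group Γ] {T : SimpleGraph V} (ρ : Γ →* (T ≃g T)) : Prop :=
  ∀ γ : Γ, γ ≠ 1 → IsSlender (ρ γ)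

/-- An action on a tree `T` is minimal if there is no proper invariant subtree. A subtree of a tree
is the (nonempty, connected) subgraph induced on its set `S` of vertices. -/
def IsMinimalAction {Γ V : Type*} [Group Γ] {T : SimpleGraph V} (ρ : Γ →* (T ≃g T)) : Prop :=
  ∀ S : Set V, (T.induce S).IsTree → (∀ γ : Γ, ∀ v ∈ S, ρ γ v ∈ S) → S = Set.univ

/-- The action has a global fixed point in `∂T`. -/
def HasFixedBoundaryPoint {Γ V : Type*} [Group Γ] {T : SimpleGraph V} (ρ : Γ →* (T ≃g T)) : Prop :=
  ∃ ξ : TreeBoundary T, ∀ γ : Γ, boundaryMap (ρ γ) ξ = ξ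

/-- Powers groups. -/
def IsPowersGroup (Γ : Type*) [Group Γ] : Prop :=
  Nontrivial Γ ∧
    ∀ F : Finset Γ, (1 : Γ) ∉ F → ∀ N : ℕ, 1 ≤ N →
      ∃ C D : Set Γ, C ∪ D = Set.univ ∧ C ∩ D = ∅ ∧
        ∃ γ : Fin N → Γ,
          (∀ f ∈ F, ((fun x => f * x) '' C) ∩ C = ∅) ∧
          (∀ j k : Fin N, j ≠ k → ((fun x => γ j * x) '' D) ∩ ((fun x => γ k * x) '' D) = ∅)

/-- Strongly Powers groups: every nontrivial subnormal subgroup is a Powers group. -/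
def IsStronglyPowersGroup (Γ : Type*) [Group Γ] : Prop :=
  ∀ N : Subgroup Γ, N.IsSubnormal → N ≠ ⊥ → IsPowersGroup N

/-!
Everything happens on the vertices of `T`, through its half-trees. An end of `T` is encoded by an
*end map* `φ`, which sends each vertex to its neighbour towards the end, and a subgroup `N` of `Γ`
is studied through two conditions: every `N`-orbit of vertices meets every half-tree
(`OrbitsMeetHalfTrees`), and there is no `N`-equivariant end map (`¬ FixesEnd`). For `N = Γ` they
follow from minimality and from the absence of a fixed boundary point.

The two conditions provide, for each half-tree `H`, a *flip* `g ∈ N` with `g Hᶜ ⊆ H`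
(`exists_flip`): without flips the complements of the translates of `H` intersect pairwise, and as
no vertex lies in all of them, they define an invariant end. With flips, every half-tree can be moved into
every other one, and since `T` has a branch vertex (there are no pending rays), each half-tree
contains any number of pairwise disjoint half-trees. Hence `Hᶜ` has any number of pairwise disjoint
translates (`exists_disjoint_translates`).

Slenderness gives, for a finite set `F` of nontrivial elements, a half-tree `H` with `f H`
disjoint from `H` for all `f ∈ F`: a ray in a given half-tree whose end is moved by `f` has, far
along, half-trees that `f` moves off themselves. With a base vertex `v`, the set
`C = {x | x v ∈ H}` and its complement then form the partition required of a Powers group.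

Finally, both conditions pass from `K` to a nontrivial normal subgroup `N` of `K`, hence to
subnormal subgroups. If an `N`-orbit avoids a half-tree, then a flip in `K` produces an `N`-orbit
avoiding the complementary one, so `N` fixes the edge in between; the fixed vertices of `N` being
`K`-invariant, `N` acts trivially, against slenderness. And two different `N`-equivariant end maps
would differ at every vertex, which makes `T` a line; so an `N`-equivariant end map is unique, and
therefore `K`-equivariant.
-/

/-! ### Half-trees -/

section HalfTree

variable {V : Type*} {T : SimpleGraph V}

/-- The half-tree of an oriented edge from `s` to `t`: the vertices nearer to `t` than to `s`.
It is the set of vertices behind `shadow`, with the two ends of the edge as separate arguments; it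
is meant for adjacent `s` and `t`. -/
def halfTree (T : SimpleGraph V) (s t : V) : Set V := {v | T.dist t v < T.dist s v}

theorem mem_halfTree {s t v : V} : v ∈ halfTree T s t ↔ T.dist t v < T.dist s v := Iff.rfl

theorem dist_eq_add_one_or_of_adj (hT : T.IsTree) {u v : V} (h : T.Adj u v) (w : V) :
    T.dist u w = T.dist v w + 1 ∨ T.dist v w = T.dist u w + 1 := by
  rw [T.dist_comm (u := u), T.dist_comm (u := v)]
  exact hT.dist_eq_dist_add_one_of_adj w h

theorem exists_adj_dist_lt (hT : T.IsTree) {v w : V} (h : v ≠ w) :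
    ∃ u, T.Adj v u ∧ T.dist u w < T.dist v w := by
  obtain ⟨p, hp⟩ := hT.connected.exists_walk_length_eq_dist v w
  cases p with
  | nil => exact absurd rfl h
  | cons hvu q =>
    refine ⟨_, hvu, ?_⟩
    have := SimpleGraph.dist_le q
    rw [SimpleGraph.Walk.length_cons] at hp
    omega

/-- In a tree, a vertex has at most one neighbour that is closer to a given vertex. -/
theorem eq_of_adj_of_dist_lt (hT : T.IsTree) {v u u' w : V} (hu : T.Adj v u) (hu' : T.Adj v u')
    (h : T.dist u w < T.dist v w) (h' : T.dist u' w < T.dist v w) : u = u' := by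
  obtain ⟨p, hp⟩ := hT.connected.exists_walk_length_eq_dist u w
  obtain ⟨p', hp'⟩ := hT.connected.exists_walk_length_eq_dist u' w
  have h1 := dist_eq_add_one_or_of_adj hT hu w
  have h2 := dist_eq_add_one_or_of_adj hT hu' w
  have hq : (SimpleGraph.Walk.cons hu p).IsPath :=
    SimpleGraph.Walk.isPath_of_length_eq_dist _ (by rw [SimpleGraph.Walk.length_cons]; omega)
  have hq' : (SimpleGraph.Walk.cons hu' p').IsPath :=
    SimpleGraph.Walk.isPath_of_length_eq_dist _ (by rw [SimpleGraph.Walk.length_cons]; omega)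
  have := (hT.existsUnique_path v w).unique hq hq'
  simpa using congrArg SimpleGraph.Walk.snd this

theorem notMem_halfTree_iff (hT : T.IsTree) {s t : V} (h : T.Adj s t) {v : V} :
    v ∉ halfTree T s t ↔ v ∈ halfTree T t s := by
  have := dist_eq_add_one_or_of_adj hT h v
  simp only [mem_halfTree]
  omega

theorem right_mem_halfTree {s t : V} (h : T.Adj s t) : t ∈ halfTree T s t := by
  simp [mem_halfTree, SimpleGraph.dist_eq_one_iff_adj.mpr h]

/-- Half-trees issuing from the same vertex in different directions are disjoint. -/
theorem eq_of_mem_halfTree (hT : T.IsTree) {v u u' w : V} (hu : T.Adj v u) (hu' : T.Adj v u')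
    (h : w ∈ halfTree T v u) (h' : w ∈ halfTree T v u') : u = u' :=
  eq_of_adj_of_dist_lt hT hu hu' h h'

/-- The only edge leaving a half-tree is the one that defines it. -/
theorem eq_of_adj_of_mem_of_notMem (hT : T.IsTree) {s t a b : V} (hst : T.Adj s t)
    (hab : T.Adj a b) (ha : a ∈ halfTree T s t) (hb : b ∉ halfTree T s t) : a = t ∧ b = s := by
  rw [mem_halfTree] at ha hb
  have h1 := dist_eq_add_one_or_of_adj hT hst a
  have h2 := dist_eq_add_one_or_of_adj hT hst b
  have hd := SimpleGraph.dist_eq_one_iff_adj.mpr hab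
  have h3 := hT.connected.dist_triangle (u := t) (v := a) (w := b)
  have h4 := hT.connected.dist_triangle (u := s) (v := b) (w := a)
  rw [T.dist_comm (u := b) (v := a)] at h4
  have hbs : b = s := by
    by_contra hne
    obtain ⟨s', hs', hlt⟩ := exists_adj_dist_lt hT (Ne.symm hne)
    have h5 := hT.connected.dist_triangle (u := s') (v := b) (w := a)
    rw [T.dist_comm (u := b) (v := a)] at h5
    have := eq_of_adj_of_dist_lt hT hst hs' (w := a) (by omega) (by omega)
    subst this
    omega
  subst hbs
  refine ⟨?_, rfl⟩
  rw [SimpleGraph.dist_self] at h2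
  have h0 : T.dist t a = 0 := by
    rw [SimpleGraph.dist_self] at h4
    omega
  exact ((hT.connected.dist_eq_zero_iff).mp h0).symm

/-- A half-tree is connected, so it lies inside any half-tree which it meets and whose defining
edge it does not cross. -/
theorem halfTree_subset (hT : T.IsTree) {s t a b : V} (hst : T.Adj s t) (hab : T.Adj a b)
    (hs : s ∉ halfTree T a b) (hb : b ∈ halfTree T s t) : halfTree T a b ⊆ halfTree T s t := by
  suffices h : ∀ n v, T.dist v b = n → v ∈ halfTree T a b → v ∈ halfTree T s t from
    fun v hv => h _ v rfl hv
  intro n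
  induction n with
  | zero =>
    intro v hv _
    rwa [(hT.connected.dist_eq_zero_iff).mp hv]
  | succ n ih =>
    intro v hv hvab
    have hne : v ≠ b := by
      rintro rfl
      simp at hv
    obtain ⟨w, hvw, hlt⟩ := exists_adj_dist_lt hT hne
    have h1 := dist_eq_add_one_or_of_adj hT hvw b
    have hw : w ∈ halfTree T a b := by
      by_contra hw
      have := (eq_of_adj_of_mem_of_notMem hT hab hvw hvab hw).1
      exact hne this
    by_contra hvst
    have hws := ih w (by omega) hw
    exact hs ((eq_of_adj_of_mem_of_notMem hT hst hvw.symm hws hvst).2 ▸ hvab)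

theorem dist_lt_of_mem_of_notMem (hT : T.IsTree) {s t x y : V} (hst : T.Adj s t)
    (hx : x ∈ halfTree T s t) (hy : y ∉ halfTree T s t) : T.dist s y < T.dist x y := by
  induction hn : T.dist x y generalizing x with
  | zero =>
    rw [hT.connected.dist_eq_zero_iff] at hn
    exact absurd (hn ▸ hx) hy
  | succ n ih =>
    obtain ⟨w, hxw, hlt⟩ := exists_adj_dist_lt hT (v := x) (w := y) (fun h => hy (h ▸ hx))
    have h1 := dist_eq_add_one_or_of_adj hT hxw y
    by_cases hw : w ∈ halfTree T s t
    · have := ih hw (by omega)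
      omega
    · rw [(eq_of_adj_of_mem_of_notMem hT hst hxw hx hw).2] at hlt
      omega

theorem exists_adj_mem_halfTree (hT : T.IsTree) {v w : V} (h : v ≠ w) :
    ∃ u, T.Adj v u ∧ w ∈ halfTree T v u :=
  exists_adj_dist_lt hT h

theorem map_mem_halfTree_iff (φ : T ≃g T) {s t v : V} :
    φ v ∈ halfTree T (φ s) (φ t) ↔ v ∈ halfTree T s t := by
  rw [mem_halfTree, mem_halfTree, dist_map_automorphism, dist_map_automorphism]

end HalfTree

/-! ### Rays -/

section Rays

variable {V : Type*} {T : SimpleGraph V}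

/-- A path without backtracking in a tree is geodesic. -/
theorem dist_add_of_nonbacktracking (hT : T.IsTree) {x : ℕ → V}
    (hadj : ∀ n, T.Adj (x n) (x (n + 1))) (hne : ∀ n, x (n + 2) ≠ x n) (m k : ℕ) :
    T.dist (x (m + k)) (x m) = k := by
  induction k using Nat.twoStepInduction with
  | zero => simp
  | one => rw [SimpleGraph.dist_eq_one_iff_adj]; exact (hadj m).symm
  | more k ih1 ih2 =>
    have h := dist_eq_add_one_or_of_adj hT (hadj (m + k + 1)) (x m)
    rcases h with h | h
    · refine absurd (eq_of_adj_of_dist_lt hT (hadj (m + k + 1)) (hadj (m + k)).symm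
        (w := x m) ?_ ?_) (hne (m + k))
      · omega
      · rw [ih1]; change k < T.dist (x (m + (k + 1))) (x m); omega
    · change T.dist (x (m + k + 1 + 1)) (x m) = _
      change _ = T.dist (x (m + (k + 1))) (x m) + 1 at h
      omega

/-- The ray traced by a path without backtracking. -/
def rayOfNonbacktracking (hT : T.IsTree) (x : ℕ → V)
    (hadj : ∀ n, T.Adj (x n) (x (n + 1))) (hne : ∀ n, x (n + 2) ≠ x n) : Ray T where
  vert := x
  dist_eq m n := by
    rcases le_total m n with h | h <;> obtain ⟨k, rfl⟩ := Nat.exists_eq_add_of_le h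
    · rw [SimpleGraph.dist_comm, dist_add_of_nonbacktracking hT hadj hne]
      push_cast
      rw [abs_of_nonpos (by omega)]
      omega
    · rw [dist_add_of_nonbacktracking hT hadj hne]
      push_cast
      rw [abs_of_nonneg (by omega)]
      omega

theorem exists_adj_ne (hdeg : ∀ v : V, 1 < (T.neighborSet v).encard) (s t : V) :
    ∃ u, T.Adj t u ∧ u ≠ s := by
  obtain ⟨a, b, ha, hb, hab⟩ := Set.one_lt_encard_iff.mp (hdeg t)
  by_cases h : a = s
  · exact ⟨b, hb, fun hbs => hab (h.trans hbs.symm)⟩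
  · exact ⟨a, ha, h⟩

theorem exists_ray_of_adj (hT : T.IsTree) (hdeg : ∀ v : V, 1 < (T.neighborSet v).encard) {s t : V}
    (h : T.Adj s t) : ∃ x : Ray T, x.vert 0 = s ∧ x.vert 1 = t := by
  choose f hf hfne using exists_adj_ne hdeg
  let y : ℕ → V × V := fun n => (fun p => (p.2, f p.1 p.2))^[n] (s, t)
  have hy : ∀ n, y (n + 1) = ((y n).2, f (y n).1 (y n).2) := fun n =>
    Function.iterate_succ_apply' _ _ _
  have hadj : ∀ n, T.Adj (y n).1 (y n).2 := by
    intro n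
    induction n with
    | zero => exact h
    | succ n _ => rw [hy]; exact hf _ _
  refine ⟨rayOfNonbacktracking hT (fun n => (y n).1) (fun n => ?_) (fun n => ?_), rfl, rfl⟩
  · rw [hy]
    exact hadj n
  · change (y (n + 1 + 1)).1 ≠ (y n).1
    rw [hy (n + 1), hy n]
    exact hfne _ _

theorem Ray.adj (x : Ray T) (n : ℕ) : T.Adj (x.vert n) (x.vert (n + 1)) := by
  rw [← SimpleGraph.dist_eq_one_iff_adj]
  have := x.dist_eq n (n + 1)
  push_cast at this
  rw [abs_of_nonpos (by omega)] at this
  omega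

theorem Ray.dist_of_le (x : Ray T) {m n : ℕ} (h : m ≤ n) :
    T.dist (x.vert m) (x.vert n) = n - m := by
  have := x.dist_eq m n
  rw [abs_of_nonpos (by omega)] at this
  omega

theorem Ray.vert_mem_halfTree (x : Ray T) {m n : ℕ} (h : m < n) :
    x.vert n ∈ halfTree T (x.vert m) (x.vert (m + 1)) := by
  rw [mem_halfTree, x.dist_of_le h, x.dist_of_le h.le]
  omega

theorem Ray.vert_ne (x : Ray T) (n : ℕ) : x.vert (n + 2) ≠ x.vert n := by
  intro h
  have := x.dist_of_le (show n ≤ n + 2 by omega)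
  rw [h, SimpleGraph.dist_self] at this
  omega

/-- The half-trees along a ray leave every vertex behind. -/
theorem Ray.notMem_halfTree_of_dist_le (hT : T.IsTree) (x : Ray T) (v : V) {n : ℕ}
    (hn : T.dist (x.vert 0) v ≤ n) : v ∉ halfTree T (x.vert n) (x.vert (n + 1)) := by
  have key : ∀ n, v ∈ halfTree T (x.vert n) (x.vert (n + 1)) → n < T.dist (x.vert 0) v ∧
      T.dist (x.vert n) v + n ≤ T.dist (x.vert 0) v := by
    intro n
    induction n with
    | zero =>
      intro h
      rw [mem_halfTree] at h
      omega
    | succ n ih =>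
      intro h
      rw [mem_halfTree] at h
      have h1 := dist_eq_add_one_or_of_adj hT (x.adj n) v
      have h2 : T.dist (x.vert n) v = T.dist (x.vert (n + 1)) v + 1 := by
        rcases h1 with h1 | h1
        · exact h1
        · exact absurd (eq_of_adj_of_dist_lt hT (x.adj (n + 1)) (x.adj n).symm h (by omega))
            (x.vert_ne n)
      have := ih (by rw [mem_halfTree]; omega)
      omega
  intro h
  have := (key n h).1
  omega

/-- If a vertex of a ray lies in a half-tree, which the ray enters away from its base, then the
ray stays there, together with the half-trees along it. -/
theorem Ray.halfTree_subset (hT : T.IsTree) (x : Ray T) {s t : V} (hst : T.Adj s t) {n : ℕ}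
    (hn : T.dist (x.vert 0) s ≤ n) (hx : x.vert (n + 1) ∈ halfTree T s t) :
    halfTree T (x.vert n) (x.vert (n + 1)) ⊆ halfTree T s t :=
  _root_.halfTree_subset hT hst (x.adj n) (x.notMem_halfTree_of_dist_le hT s hn) hx

theorem Ray.exists_direction (hT : T.IsTree) (x : Ray T) (v : V) :
    ∃ u, T.Adj v u ∧ ∃ n₀, ∀ n, n₀ ≤ n →
      halfTree T (x.vert n) (x.vert (n + 1)) ⊆ halfTree T v u := by
  obtain ⟨n₀, hn₀⟩ : ∃ n₀, T.dist (x.vert 0) v ≤ n₀ := ⟨_, le_rfl⟩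
  have hne : v ≠ x.vert (n₀ + 1) := by
    rintro rfl
    exact x.notMem_halfTree_of_dist_le hT _ hn₀ (x.vert_mem_halfTree (Nat.lt_succ_self _))
  obtain ⟨u, hu, hmem⟩ := exists_adj_mem_halfTree hT hne
  have h0 := x.halfTree_subset hT hu hn₀ hmem
  exact ⟨u, hu, n₀, fun n hn =>
    x.halfTree_subset hT hu (hn₀.trans hn) (h0 (x.vert_mem_halfTree (by omega)))⟩

end Rays

/-! ### Ends as end maps -/

section EndMap

variable {V : Type*} {T : SimpleGraph V}

/-- An end of a tree, encoded by the map sending each vertex to its neighbour in the direction of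
the end. Every edge is then traversed in exactly one of its two directions. -/
structure IsEndMap (T : SimpleGraph V) (φ : V → V) : Prop where
  adj : ∀ v, T.Adj v (φ v)
  eq_iff : ∀ u v, T.Adj u v → (φ u = v ↔ φ v ≠ u)

/-- Every ray defines an end map. -/
theorem Ray.exists_isEndMap (hT : T.IsTree) (x : Ray T) : ∃ φ, IsEndMap T φ ∧
    ∀ v, ∃ n₀, ∀ n, n₀ ≤ n → halfTree T (x.vert n) (x.vert (n + 1)) ⊆ halfTree T v (φ v) := by
  choose φ hφ n₀ hn₀ using x.exists_direction hT
  refine ⟨φ, ⟨hφ, fun u v huv => ?_⟩, fun v => ⟨n₀ v, hn₀ v⟩⟩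
  -- a vertex far along the ray, lying in the half-trees at `u` and at `v`
  set n := max (n₀ u) (n₀ v)
  have hw := right_mem_halfTree (x.adj n)
  have hu := hn₀ u n (le_max_left _ _) hw
  have hv := hn₀ v n (le_max_right _ _) hw
  constructor
  · rintro h h'
    rw [h] at hu
    rw [h'] at hv
    exact ((notMem_halfTree_iff hT huv).mpr hv) hu
  · intro h
    by_contra h'
    by_cases hc : x.vert (n + 1) ∈ halfTree T u v
    · exact h' (eq_of_mem_halfTree hT (hφ u) huv hu hc)
    · exact h (eq_of_mem_halfTree hT (hφ v) huv.symm hv ((notMem_halfTree_iff hT huv).mp hc))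

theorem IsEndMap.iterate_adj {φ : V → V} (hφ : IsEndMap T φ) (v : V) (n : ℕ) :
    T.Adj (φ^[n] v) (φ^[n + 1] v) := by
  rw [Function.iterate_succ_apply']
  exact hφ.adj _

theorem IsEndMap.iterate_ne {φ : V → V} (hφ : IsEndMap T φ) (v : V) (n : ℕ) :
    φ^[n + 2] v ≠ φ^[n] v := by
  rw [Function.iterate_succ_apply', Function.iterate_succ_apply']
  exact (hφ.eq_iff _ _ (hφ.adj _)).mp rfl

/-- The ray from a vertex towards the end encoded by an end map. -/
def IsEndMap.ray (hT : T.IsTree) {φ : V → V} (hφ : IsEndMap T φ) (v : V) : Ray T :=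
  rayOfNonbacktracking hT (fun n => φ^[n] v) (hφ.iterate_adj v) (hφ.iterate_ne v)

theorem IsEndMap.exists_iterate_eq (hT : T.IsTree) {φ : V → V} (hφ : IsEndMap T φ) (a b : V) :
    ∃ i j, φ^[i] a = φ^[j] b := by
  obtain ⟨p⟩ := hT.connected.preconnected b a
  induction p with
  | nil => exact ⟨0, 0, rfl⟩
  | @cons u v w huv p ih =>
    obtain ⟨i, j, hij⟩ := ih
    by_cases h : φ u = v
    · exact ⟨i, j + 1, by rw [Function.iterate_succ_apply, h, hij]⟩
    · have h' : φ v = u := (hφ.eq_iff v u huv.symm).mpr h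
      refine ⟨i + 1, j, ?_⟩
      rw [Function.iterate_succ_apply', hij, ← Function.iterate_succ_apply' φ,
        Function.iterate_succ_apply, h']

theorem cofinal_of_iterate (hT : T.IsTree) {φ : V → V} (hφ : IsEndMap T φ) {x y : Ray T}
    (hx : ∀ n, φ (x.vert n) = x.vert (n + 1)) (hy : ∀ n, φ (y.vert n) = y.vert (n + 1)) :
    x.Cofinal y := by
  have hit : ∀ z : Ray T, (∀ n, φ (z.vert n) = z.vert (n + 1)) → ∀ m n,
      z.vert (m + n) = φ^[m] (z.vert n) := by
    intro z hz m n
    induction m with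
    | zero => simp
    | succ m ih => rw [Function.iterate_succ_apply', ← ih, hz]; congr 1; omega
  obtain ⟨i, j, hij⟩ := hφ.exists_iterate_eq hT (x.vert 0) (y.vert 0)
  refine ⟨i - j, j, fun n m hn hm => ?_⟩
  obtain ⟨k, rfl⟩ := Nat.exists_eq_add_of_le' hn
  obtain rfl : m = k + i := by omega
  rw [hit y hy k j, hit x hx k i, ← add_zero j, ← add_zero i, hit y hy, hit x hx, hij]

theorem Ray.map_vert_eq_of_subset (hT : T.IsTree) (x : Ray T) {φ : V → V} (hφ : IsEndMap T φ)
    (h : ∀ v, ∃ n₀, ∀ n, n₀ ≤ n →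
      halfTree T (x.vert n) (x.vert (n + 1)) ⊆ halfTree T v (φ v)) (n : ℕ) :
    φ (x.vert n) = x.vert (n + 1) := by
  obtain ⟨n₀, hn₀⟩ := h (x.vert n)
  have h1 := hn₀ (max n₀ n) (le_max_left _ _) (right_mem_halfTree (x.adj _))
  exact eq_of_mem_halfTree hT (hφ.adj _) (x.adj n) h1 (x.vert_mem_halfTree (by omega))

/-- Half-trees far along two rays with different ends are disjoint. -/
theorem Ray.exists_disjoint_of_not_cofinal (hT : T.IsTree) {x y : Ray T} (h : ¬ x.Cofinal y) :
    ∃ n₀, ∀ n, n₀ ≤ n → Disjoint (halfTree T (x.vert n) (x.vert (n + 1)))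
      (halfTree T (y.vert n) (y.vert (n + 1))) := by
  obtain ⟨φ, hφ, hxφ⟩ := x.exists_isEndMap hT
  obtain ⟨ψ, hψ, hyψ⟩ := y.exists_isEndMap hT
  obtain ⟨v, hv⟩ : ∃ v, φ v ≠ ψ v := by
    by_contra! hall
    obtain rfl : φ = ψ := funext hall
    exact h (cofinal_of_iterate hT hφ (x.map_vert_eq_of_subset hT hφ hxφ)
      (y.map_vert_eq_of_subset hT hφ hyψ))
  obtain ⟨n₁, h₁⟩ := hxφ v
  obtain ⟨n₂, h₂⟩ := hyψ v
  refine ⟨max n₁ n₂, fun n hn => Set.disjoint_left.mpr fun w hw hw' => hv ?_⟩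
  exact eq_of_mem_halfTree hT (hφ.adj v) (hψ.adj v) (h₁ n (by omega) hw) (h₂ n (by omega) hw')

end EndMap

/-! ### Minimal actions without fixed end -/

section Action

variable {V Γ : Type*} [Group Γ] {T : SimpleGraph V} {ρ : Γ →* (T ≃g T)} {N K : Subgroup Γ}

theorem map_mul_act (ρ : Γ →* (T ≃g T)) (g h : Γ) (v : V) : ρ (g * h) v = ρ g (ρ h v) := by
  rw [map_mul]
  rfl

theorem map_one_act (ρ : Γ →* (T ≃g T)) (v : V) : ρ 1 v = v := by
  rw [map_one]
  rfl

theorem map_inv_act_act (ρ : Γ →* (T ≃g T)) (g : Γ) (v : V) : ρ g⁻¹ (ρ g v) = v := by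
  rw [← map_mul_act, inv_mul_cancel, map_one_act]

theorem map_act_inv_act (ρ : Γ →* (T ≃g T)) (g : Γ) (v : V) : ρ g (ρ g⁻¹ v) = v := by
  rw [← map_mul_act, mul_inv_cancel, map_one_act]

theorem adj_act (ρ : Γ →* (T ≃g T)) (g : Γ) {u v : V} (h : T.Adj u v) :
    T.Adj (ρ g u) (ρ g v) :=
  (ρ g).map_adj_iff.mpr h

theorem act_mem_halfTree_iff (ρ : Γ →* (T ≃g T)) (g : Γ) {s t v : V} :
    ρ g v ∈ halfTree T s t ↔ v ∈ halfTree T (ρ g⁻¹ s) (ρ g⁻¹ t) := by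
  rw [← map_mem_halfTree_iff (ρ g) (v := v), map_act_inv_act, map_act_inv_act]

theorem mem_halfTree_act_iff (ρ : Γ →* (T ≃g T)) (g : Γ) {s t v : V} :
    v ∈ halfTree T (ρ g s) (ρ g t) ↔ ρ g⁻¹ v ∈ halfTree T s t := by
  rw [act_mem_halfTree_iff, inv_inv]

/-- Every orbit of vertices under the subgroup `N` meets every half-tree. For the whole group, this
is what minimality amounts to; unlike minimality, it mentions no subtrees. -/
def OrbitsMeetHalfTrees (ρ : Γ →* (T ≃g T)) (N : Subgroup Γ) : Prop :=
  ∀ v s t : V, T.Adj s t → ∃ g ∈ N, ρ g v ∈ halfTree T s t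

/-- The subgroup `N` fixes an end of the tree, the end being given by its end map. -/
def FixesEnd (ρ : Γ →* (T ≃g T)) (N : Subgroup Γ) : Prop :=
  ∃ φ, IsEndMap T φ ∧ ∀ g ∈ N, ∀ v, φ (ρ g v) = ρ g (φ v)

/-- The convex hull of an orbit is the intersection of the complements of the half-trees which the
orbit does not meet. It is an invariant subtree. -/
theorem IsMinimalAction.orbitsMeetHalfTrees (hT : T.IsTree) (hmin : IsMinimalAction ρ) :
    OrbitsMeetHalfTrees ρ ⊤ := by
  intro v s t hst
  by_contra! hcon
  let S : Set V := {w | ∀ a b, T.Adj a b → (∀ g, ρ g v ∉ halfTree T a b) → w ∉ halfTree T a b}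
  have hvS : v ∈ S := fun a b _ h => by simpa only [map_one_act] using h 1
  have hreach : ∀ n (w : S), T.dist w v = n → (T.induce S).Reachable w ⟨v, hvS⟩ := by
    intro n
    induction n with
    | zero =>
      intro w hw
      rw [hT.connected.dist_eq_zero_iff] at hw
      rw [show w = ⟨v, hvS⟩ from Subtype.ext hw]
    | succ n ih =>
      rintro ⟨w, hwS⟩ hw
      have hne : w ≠ v := by
        rintro rfl
        simp at hw
      obtain ⟨u, hwu, hlt⟩ := exists_adj_dist_lt hT hne
      have h1 := dist_eq_add_one_or_of_adj hT hwu v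
      have huS : u ∈ S := by
        intro a b hab horb hu
        -- the edge from `w` to `u` leaves the hull and yet leads towards `v`
        obtain ⟨rfl, rfl⟩ := eq_of_adj_of_mem_of_notMem hT hab hwu.symm hu (hwS a b hab horb)
        exact hvS _ _ hab horb hlt
      have hadj : (T.induce S).Adj ⟨w, hwS⟩ ⟨u, huS⟩ := hwu
      exact hadj.reachable.trans (ih ⟨u, huS⟩ (by simp only at hw ⊢; omega))
  have htree : (T.induce S).IsTree := by
    refine ⟨?_, hT.isAcyclic.induce S⟩
    have : Nonempty S := ⟨⟨v, hvS⟩⟩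
    exact ⟨fun w w' => (hreach _ w rfl).trans (hreach _ w' rfl).symm⟩
  have hinv : ∀ γ : Γ, ∀ w ∈ S, ρ γ w ∈ S := by
    intro γ w hw a b hab horb hmem
    rw [act_mem_halfTree_iff] at hmem
    refine hw _ _ (adj_act ρ _ hab) (fun g hg => ?_) hmem
    rw [mem_halfTree_act_iff, inv_inv, ← map_mul_act] at hg
    exact horb _ hg
  have htS : t ∈ S := by
    rw [hmin S htree hinv]
    trivial
  exact htS s t hst (fun g => hcon g trivial) (right_mem_halfTree hst)

theorem not_fixesEnd_top (hT : T.IsTree) (hfix : ¬ HasFixedBoundaryPoint ρ) :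
    ¬ FixesEnd ρ ⊤ := by
  rintro ⟨φ, hφ, hequiv⟩
  obtain ⟨v⟩ := hT.connected.nonempty
  refine hfix ⟨(hφ.ray hT v).toBoundary, fun γ => Quotient.sound ?_⟩
  have hray : ∀ n, φ ((hφ.ray hT v).vert n) = (hφ.ray hT v).vert (n + 1) := fun n =>
    (Function.iterate_succ_apply' φ n v).symm
  refine cofinal_of_iterate hT hφ (fun n => ?_) hray
  change φ (ρ γ _) = ρ γ _
  rw [hequiv γ trivial, hray]

/-- Some element moves the complement of a given half-tree into the half-tree. Otherwise the
complements of the translates of the half-tree pairwise intersect, and the direction in which such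
complements lie, seen from a vertex, is a well-defined invariant end map. -/
theorem exists_flip (hT : T.IsTree) (hM : OrbitsMeetHalfTrees ρ N) (hE : ¬ FixesEnd ρ N) {s t : V}
    (hst : T.Adj s t) : ∃ g ∈ N, ∀ v ∉ halfTree T s t, ρ g v ∈ halfTree T s t := by
  by_contra! hcon
  have hts := hst.symm
  have hmeet : ∀ g ∈ N, ∀ h ∈ N, ∃ w, w ∈ halfTree T (ρ g t) (ρ g s) ∧
      w ∈ halfTree T (ρ h t) (ρ h s) := by
    intro g hg h hh
    obtain ⟨v, hv, hv'⟩ := hcon (h⁻¹ * g) (N.mul_mem (N.inv_mem hh) hg)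
    rw [notMem_halfTree_iff hT hst] at hv hv'
    refine ⟨ρ g v, (map_mem_halfTree_iff (ρ g)).mpr hv, ?_⟩
    rwa [mem_halfTree_act_iff, ← map_mul_act]
  have hex : ∀ v, ∃ u, T.Adj v u ∧ ∃ g ∈ N,
      halfTree T (ρ g t) (ρ g s) ⊆ halfTree T v u := by
    intro v
    obtain ⟨g, hg, hgv⟩ := hM v s t hst
    have hv : v ∉ halfTree T (ρ g⁻¹ t) (ρ g⁻¹ s) := by
      rw [notMem_halfTree_iff hT (adj_act ρ _ hts), mem_halfTree_act_iff, inv_inv]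
      exact hgv
    have hne : v ≠ ρ g⁻¹ s := by
      rintro rfl
      exact hv (right_mem_halfTree (adj_act ρ _ hts))
    obtain ⟨u, hu, hmem⟩ := exists_adj_mem_halfTree hT hne
    exact ⟨u, hu, g⁻¹, N.inv_mem hg, halfTree_subset hT hu (adj_act ρ _ hts) hv hmem⟩
  choose φ hφ k hk hsub using hex
  refine hE ⟨φ, ⟨hφ, fun u v huv => ?_⟩, fun g hg v => ?_⟩
  · obtain ⟨w, hw, hw'⟩ := hmeet _ (hk u) _ (hk v)
    have hu := hsub u hw
    have hv := hsub v hw'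
    constructor
    · rintro h h'
      rw [h] at hu
      rw [h'] at hv
      exact ((notMem_halfTree_iff hT huv).mpr hv) hu
    · intro h
      by_contra h'
      by_cases hc : w ∈ halfTree T u v
      · exact h' (eq_of_mem_halfTree hT (hφ u) huv hu hc)
      · exact h (eq_of_mem_halfTree hT (hφ v) huv.symm hv ((notMem_halfTree_iff hT huv).mp hc))
  · obtain ⟨w, hw, hw'⟩ := hmeet _ (hk (ρ g v)) _ (N.mul_mem hg (hk v))
    refine eq_of_mem_halfTree hT (hφ _) (adj_act ρ g (hφ v)) (hsub _ hw) ?_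
    rw [mem_halfTree_act_iff]
    apply hsub v
    rwa [mem_halfTree_act_iff, ← map_mul_act, ← mul_inv_rev, ← mem_halfTree_act_iff]

/-- Every half-tree can be moved into every other one. -/
theorem exists_map_halfTree_subset (hT : T.IsTree) (hdeg : ∀ v : V, 1 < (T.neighborSet v).encard)
    (hM : OrbitsMeetHalfTrees ρ N) (hE : ¬ FixesEnd ρ N) {a b s t : V} (hab : T.Adj a b)
    (hst : T.Adj s t) : ∃ g ∈ N, ∀ v ∈ halfTree T a b, ρ g v ∈ halfTree T s t := by
  obtain ⟨t', htt', hne⟩ := exists_adj_ne hdeg s t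
  have hs : s ∉ halfTree T t t' := fun h =>
    hne (eq_of_mem_halfTree hT htt' hst.symm h (right_mem_halfTree hst.symm))
  have htt'_mem : t' ∈ halfTree T s t := by
    by_contra h
    exact hne (eq_of_adj_of_mem_of_notMem hT hst htt' (right_mem_halfTree hst) h).2
  have hsub := halfTree_subset hT hst htt' hs htt'_mem
  obtain ⟨g, hg, hga⟩ := hM a t t' htt'
  have hgb : ρ g b ∈ halfTree T s t := by
    by_cases h : ρ g b ∈ halfTree T t t'
    · exact hsub h
    · rw [(eq_of_adj_of_mem_of_notMem hT htt' (adj_act ρ g hab) hga h).2]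
      exact right_mem_halfTree hst
  by_cases hs' : s ∈ halfTree T (ρ g a) (ρ g b)
  · -- the translate of the complementary half-tree is inside: precompose with a flip
    obtain ⟨f, hf, hflip⟩ := exists_flip hT hM hE hab.symm
    refine ⟨g * f, N.mul_mem hg hf, fun v hv => ?_⟩
    rw [map_mul_act]
    refine halfTree_subset hT hst (adj_act ρ g hab.symm)
      ((notMem_halfTree_iff hT (adj_act ρ g hab.symm)).mpr hs') (hsub hga) ?_
    rw [map_mem_halfTree_iff]
    exact hflip v ((notMem_halfTree_iff hT hab.symm).mpr hv)
  · refine ⟨g, hg, fun v hv => halfTree_subset hT hst (adj_act ρ g hab) hs' hgb ?_⟩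
    rwa [map_mem_halfTree_iff]

/-- A tree in which no ray is pending has a vertex of degree at least `3`. -/
theorem exists_branch_vertex (hT : T.IsTree) (hdeg : ∀ v : V, 1 < (T.neighborSet v).encard)
    (hpend : ∀ x : Ray T, ¬ x.IsPending) : ∃ p a b c : V, T.Adj p a ∧ T.Adj p b ∧ T.Adj p c ∧
      a ≠ b ∧ a ≠ c ∧ b ≠ c := by
  obtain ⟨v⟩ := hT.connected.nonempty
  obtain ⟨u, hu, -⟩ := exists_adj_ne hdeg v v
  obtain ⟨x, -, -⟩ := exists_ray_of_adj hT hdeg hu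
  by_contra! hcon
  refine hpend x ⟨0, fun n _ => ?_⟩
  obtain ⟨a, b, ha, hb, hab⟩ := Set.one_lt_encard_iff.mp (hdeg (x.vert n))
  rw [Set.encard_eq_two]
  refine ⟨a, b, hab, Set.Subset.antisymm (fun c hc => ?_) ?_⟩
  · by_contra hc'
    simp only [Set.mem_insert_iff, Set.mem_singleton_iff, not_or] at hc'
    exact Ne.symm hc'.2 (hcon _ a b c ha hb hc hab (Ne.symm hc'.1))
  · rintro c (rfl | rfl)
    exacts [ha, hb]

/-- Every half-tree contains any finite number of pairwise disjoint half-trees. -/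
theorem exists_disjoint_halfTrees (hT : T.IsTree)
    (hdeg : ∀ v : V, 1 < (T.neighborSet v).encard) (hpend : ∀ x : Ray T, ¬ x.IsPending)
    (hM : OrbitsMeetHalfTrees ρ N) (hE : ¬ FixesEnd ρ N) (n : ℕ) {s t : V} (hst : T.Adj s t) :
    ∃ a b : Fin n → V, (∀ i, T.Adj (a i) (b i)) ∧
      (∀ i, halfTree T (a i) (b i) ⊆ halfTree T s t) ∧
      ∀ i j, i ≠ j → Disjoint (halfTree T (a i) (b i)) (halfTree T (a j) (b j)) := by
  induction n generalizing s t with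
  | zero => exact ⟨Fin.elim0, Fin.elim0, fun i => i.elim0, fun i => i.elim0, fun i => i.elim0⟩
  | succ n ih =>
    obtain ⟨p, u, v, w, hu, hv, hw, huv, huw, hvw⟩ := exists_branch_vertex hT hdeg hpend
    obtain ⟨g, -, hg⟩ := exists_map_halfTree_subset hT hdeg hM hE hw.symm hst
    have key : ∀ z, T.Adj p z → z ≠ w →
        halfTree T (ρ g p) (ρ g z) ⊆ halfTree T s t := by
      intro z hz hzw y hy
      rw [← map_act_inv_act ρ g y]
      refine hg _ ((notMem_halfTree_iff hT hw).mp fun h => hzw ?_)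
      exact eq_of_mem_halfTree hT hz hw ((mem_halfTree_act_iff ρ g).mp hy) h
    have hdisj : Disjoint (halfTree T (ρ g p) (ρ g u)) (halfTree T (ρ g p) (ρ g v)) :=
      Set.disjoint_left.mpr fun y hy hy' => huv ((ρ g).injective
        (eq_of_mem_halfTree hT (adj_act ρ g hu) (adj_act ρ g hv) hy hy'))
    obtain ⟨a, b, hab, hsub, hd⟩ := ih (adj_act ρ g hv)
    refine ⟨Fin.cons (ρ g p) a, Fin.cons (ρ g u) b, ?_, ?_, ?_⟩
    · intro i
      refine Fin.cases ?_ (fun i => ?_) i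
      · exact adj_act ρ g hu
      · exact hab i
    · intro i
      refine Fin.cases ?_ (fun i => ?_) i
      · exact key u hu huw
      · exact (hsub i).trans (key v hv hvw)
    · intro i j
      refine Fin.cases ?_ (fun i => ?_) i <;> refine Fin.cases ?_ (fun j => ?_) j
      · exact fun h => absurd rfl h
      · exact fun _ => hdisj.mono_right (hsub j)
      · exact fun _ => (hdisj.mono_right (hsub i)).symm
      · exact fun h => hd i j fun hij => h (congrArg Fin.succ hij)

/-- The complement of a half-tree has any finite number of pairwise disjoint translates. -/
theorem exists_disjoint_translates (hT : T.IsTree)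
    (hdeg : ∀ v : V, 1 < (T.neighborSet v).encard) (hpend : ∀ x : Ray T, ¬ x.IsPending)
    (hM : OrbitsMeetHalfTrees ρ N) (hE : ¬ FixesEnd ρ N) (n : ℕ) {s t : V} (hst : T.Adj s t) :
    ∃ g : Fin n → N, ∀ i j, i ≠ j → ∀ v ∉ halfTree T s t, ∀ w ∉ halfTree T s t,
      ρ (g i) v ≠ ρ (g j) w := by
  obtain ⟨a, b, hab, -, hd⟩ := exists_disjoint_halfTrees hT hdeg hpend hM hE n hst
  choose g hg hsub using fun i => exists_map_halfTree_subset hT hdeg hM hE hst.symm (hab i)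
  refine ⟨fun i => ⟨g i, hg i⟩, fun i j hij v hv w hw h => ?_⟩
  rw [notMem_halfTree_iff hT hst] at hv hw
  exact Set.disjoint_left.mp (hd i j hij) (hsub i v hv) (h ▸ hsub j w hw)

/-! ### Slender actions -/

/-- A nontrivial element of a slender group moves some smaller half-tree off itself. -/
theorem IsSlenderAction.exists_halfTree_disjoint (hT : T.IsTree)
    (hdeg : ∀ v : V, 1 < (T.neighborSet v).encard) (hslender : IsSlenderAction ρ) {γ : Γ}
    (hγ : γ ≠ 1) {s t : V} (hst : T.Adj s t) :
    ∃ a b, T.Adj a b ∧ halfTree T a b ⊆ halfTree T s t ∧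
      ∀ v ∈ halfTree T a b, ρ γ v ∉ halfTree T a b := by
  let e : T.Dart := ⟨(s, t), hst⟩
  obtain ⟨ξ, hξ, hmove⟩ : ∃ ξ ∈ shadow T e, boundaryMap (ρ γ) ξ ≠ ξ := by
    by_contra! hall
    have hopen : IsOpen (shadow T e) := TopologicalSpace.isOpen_generateFrom_of_mem ⟨e, rfl⟩
    have hsub : shadow T e ⊆ interior {ξ | boundaryMap (ρ γ) ξ = ξ} :=
      interior_maximal hall hopen
    rw [hslender γ hγ] at hsub
    obtain ⟨x, h0, h1⟩ := exists_ray_of_adj hT hdeg hst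
    refine hsub (show x.toBoundary ∈ shadow T e from ⟨x, rfl, 1, fun n hn => ?_⟩)
    have := x.vert_mem_halfTree (m := 0) hn
    rw [zero_add, h0, h1] at this
    exact this
  obtain ⟨x, rfl, n₀, hx⟩ := hξ
  have hcof : ¬ (Ray.map (ρ γ) x).Cofinal x := fun h => hmove (Quotient.sound h)
  obtain ⟨n₁, hdisj⟩ := Ray.exists_disjoint_of_not_cofinal hT hcof
  set n := max n₀ (max n₁ (T.dist (x.vert 0) s))
  refine ⟨_, _, x.adj n, x.halfTree_subset hT hst (by omega) (hx _ (by omega)),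
    fun v hv hv' => Set.disjoint_left.mp (hdisj n (by omega)) ?_ hv'⟩
  exact (map_mem_halfTree_iff (ρ γ)).mpr hv

theorem IsSlenderAction.exists_halfTree_disjoint_of_finset (hT : T.IsTree)
    (hdeg : ∀ v : V, 1 < (T.neighborSet v).encard) (hslender : IsSlenderAction ρ) (F : Finset Γ)
    (hF : (1 : Γ) ∉ F) :
    ∃ a b, T.Adj a b ∧ ∀ f ∈ F, ∀ v ∈ halfTree T a b, ρ f v ∉ halfTree T a b := by
  classical
  induction F using Finset.induction_on with
  | empty =>
    obtain ⟨v⟩ := hT.connected.nonempty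
    obtain ⟨u, hu, -⟩ := exists_adj_ne hdeg v v
    exact ⟨v, u, hu, by simp⟩
  | insert f F _ ih =>
    rw [Finset.mem_insert, not_or] at hF
    obtain ⟨s, t, hst, h⟩ := ih hF.2
    obtain ⟨a, b, hab, hsub, hf⟩ :=
      hslender.exists_halfTree_disjoint hT hdeg (Ne.symm hF.1) hst
    refine ⟨a, b, hab, fun f' hf' v hv hv' => ?_⟩
    rcases Finset.mem_insert.mp hf' with rfl | hf'
    · exact hf v hv hv'
    · exact h f' hf' v (hsub hv) (hsub hv')

theorem IsSlenderAction.exists_act_ne (hT : T.IsTree)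
    (hdeg : ∀ v : V, 1 < (T.neighborSet v).encard) (hslender : IsSlenderAction ρ) {γ : Γ}
    (hγ : γ ≠ 1) : ∃ v, ρ γ v ≠ v := by
  obtain ⟨v⟩ := hT.connected.nonempty
  obtain ⟨u, hu, -⟩ := exists_adj_ne hdeg v v
  obtain ⟨a, b, hab, -, h⟩ := hslender.exists_halfTree_disjoint hT hdeg hγ hu
  exact ⟨b, fun hb => h b (right_mem_halfTree hab) (hb.symm ▸ right_mem_halfTree hab)⟩

/-- The Powers partition: group elements are sorted according to whether they move a base vertex
into a suitable half-tree. -/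
theorem isPowersGroup_of_orbitsMeetHalfTrees (hT : T.IsTree)
    (hdeg : ∀ v : V, 1 < (T.neighborSet v).encard) (hpend : ∀ x : Ray T, ¬ x.IsPending)
    (hslender : IsSlenderAction ρ) (hN : N ≠ ⊥)
    (hM : OrbitsMeetHalfTrees ρ N) (hE : ¬ FixesEnd ρ N) : IsPowersGroup N := by
  refine ⟨N.nontrivial_iff_ne_bot.mpr hN, fun F hF n _ => ?_⟩
  obtain ⟨a, b, hab, h⟩ := hslender.exists_halfTree_disjoint_of_finset hT hdeg
    (F.map (Function.Embedding.subtype (· ∈ N))) (by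
      rintro h1
      obtain ⟨f, hf, hf1⟩ := Finset.mem_map.mp h1
      exact hF (Subtype.ext (a1 := f) (a2 := 1) hf1 ▸ hf))
  obtain ⟨g, hg⟩ := exists_disjoint_translates hT hdeg hpend hM hE n hab
  obtain ⟨v⟩ := hT.connected.nonempty
  let C : Set N := {x | ρ x v ∈ halfTree T a b}
  refine ⟨C, Cᶜ, Set.union_compl_self C, Set.inter_compl_self C, g, fun f hf => ?_,
    fun j k hjk => ?_⟩
  · rw [← Set.disjoint_iff_inter_eq_empty, Set.disjoint_left]
    rintro _ ⟨x, hx, rfl⟩ hfx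
    refine h f (Finset.mem_map_of_mem _ hf) _ hx ?_
    rw [← map_mul_act]
    exact hfx
  · rw [← Set.disjoint_iff_inter_eq_empty, Set.disjoint_left]
    rintro _ ⟨x, hx, rfl⟩ ⟨y, hy, hxy⟩
    refine hg k j hjk.symm _ hy _ hx ?_
    rw [← map_mul_act, ← map_mul_act]
    exact congrArg (fun z : N => ρ z v) hxy

/-! ### Normal subgroups -/

/-- If an orbit avoids a half-tree, then so does the orbit of the base of the half-tree. -/
theorem act_notMem_halfTree (hT : T.IsTree) {s t v : V} (hst : T.Adj s t)
    (h : ∀ n ∈ N, ρ n v ∉ halfTree T s t) {n : Γ} (hn : n ∈ N) : ρ n s ∉ halfTree T s t := by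
  intro hmem
  -- `m` minimizes the distance from `s` to the orbit of `v`; translating by `n` contradicts this
  obtain ⟨m, hm, hmin⟩ := (measure fun m : Γ => T.dist s (ρ m v)).wf.has_min (N : Set Γ)
    ⟨1, N.one_mem⟩
  have h1 : ¬ T.dist s (ρ (n * m) v) < T.dist s (ρ m v) := hmin _ (N.mul_mem hn hm)
  have h2 := dist_lt_of_mem_of_notMem hT hst hmem (h (n * m) (N.mul_mem hn hm))
  rw [map_mul_act] at h1 h2
  rw [dist_map_automorphism] at h2
  omega

theorem act_eq_of_normal (hT : T.IsTree) (hM : OrbitsMeetHalfTrees ρ K)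
    (hnorm : ∀ k ∈ K, ∀ n ∈ N, k * n * k⁻¹ ∈ N) {s : V} (hs : ∀ n ∈ N, ρ n s = s) (v : V) :
    ∀ n ∈ N, ρ n v = v := by
  have hfix : ∀ k ∈ K, ∀ n ∈ N, ρ n (ρ k s) = ρ k s := by
    intro k hk n hn
    have := hnorm k⁻¹ (K.inv_mem hk) n hn
    rw [inv_inv] at this
    have h := congrArg (ρ k) (hs _ this)
    rwa [← map_mul_act, ← mul_assoc, mul_inv_cancel_left, map_mul_act] at h
  obtain ⟨p⟩ := hT.connected.preconnected v s
  induction p with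
  | nil => exact hs
  | @cons u w z huw _ ih =>
    intro n hn
    obtain ⟨k, hk, hmem⟩ := hM z w u huw.symm
    have h := (map_mem_halfTree_iff (ρ n)).mpr hmem
    rw [hfix k hk n hn, ih hs hfix n hn] at h
    have hadj := adj_act ρ n huw.symm
    rw [ih hs hfix n hn] at hadj
    exact eq_of_mem_halfTree hT hadj huw.symm h hmem

/-- A subgroup with an orbit avoiding a half-tree also has an orbit avoiding the complementary
half-tree, by means of a flip in the ambient group; it then fixes the edge in between, hence
everything. -/
theorem orbitsMeetHalfTrees_of_normal (hT : T.IsTree)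
    (hdeg : ∀ v : V, 1 < (T.neighborSet v).encard) (hslender : IsSlenderAction ρ) (hN : N ≠ ⊥)
    (hM : OrbitsMeetHalfTrees ρ K) (hE : ¬ FixesEnd ρ K)
    (hnorm : ∀ k ∈ K, ∀ n ∈ N, k * n * k⁻¹ ∈ N) : OrbitsMeetHalfTrees ρ N := by
  intro v s t hst
  by_contra! hcon
  obtain ⟨k, hk, hflip⟩ := exists_flip hT hM hE hst
  have hcon' : ∀ n ∈ N, ρ n (ρ k v) ∉ halfTree T t s := by
    intro n hn
    have h1 := hnorm k⁻¹ (K.inv_mem hk) n hn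
    rw [inv_inv] at h1
    have h2 := hflip _ (hcon _ h1)
    rw [← map_mul_act, ← mul_assoc, mul_inv_cancel_left, map_mul_act] at h2
    exact (notMem_halfTree_iff hT hst.symm).mpr h2
  have hs : ∀ n ∈ N, ρ n s = s := fun n hn =>
    (eq_of_adj_of_mem_of_notMem hT hst.symm (adj_act ρ n hst)
      ((notMem_halfTree_iff hT hst).mp (act_notMem_halfTree hT hst hcon hn))
      (act_notMem_halfTree hT hst.symm hcon' hn)).1
  obtain ⟨n, hn, hne⟩ := N.bot_or_exists_ne_one.resolve_left hN
  obtain ⟨w, hw⟩ := hslender.exists_act_ne hT hdeg hne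
  exact hw (act_eq_of_normal hT hM hnorm hs w n hn)

/-- Two end maps that agree at a vertex agree on everything behind it. -/
theorem IsEndMap.eq_of_mem_halfTree (hT : T.IsTree) {φ ψ : V → V} (hφ : IsEndMap T φ)
    (hψ : IsEndMap T ψ) {w : V} (hw : φ w = ψ w) {v : V} (hv : v ∈ halfTree T (φ w) w) :
    φ v = ψ v := by
  suffices h : ∀ n u, T.dist u w = n → u ∈ halfTree T (φ w) w →
      φ u = ψ u ∧ T.dist (φ u) (φ w) < T.dist u (φ w) from (h _ v rfl hv).1
  intro n
  induction n with
  | zero =>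
    intro u hu _
    obtain rfl := hT.connected.dist_eq_zero_iff.mp hu
    exact ⟨hw, by simp [SimpleGraph.dist_eq_one_iff_adj.mpr (hφ.adj u)]⟩
  | succ n ih =>
    intro u hu hmem
    have hne : u ≠ w := by
      rintro rfl
      simp at hu
    obtain ⟨u', huu', hlt⟩ := exists_adj_dist_lt hT hne
    have h1 := dist_eq_add_one_or_of_adj hT huu' w
    have hu' : u' ∈ halfTree T (φ w) w := by
      by_contra h
      exact hne (eq_of_adj_of_mem_of_notMem hT (hφ.adj w).symm huu' hmem h).1
    obtain ⟨heq, hcl⟩ := ih u' (by omega) hu'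
    have h2 := dist_eq_add_one_or_of_adj hT (hφ.adj w) u
    have h3 := dist_eq_add_one_or_of_adj hT (hφ.adj w) u'
    rw [mem_halfTree, SimpleGraph.dist_comm, T.dist_comm (u := φ w)] at hmem hu'
    rw [T.dist_comm (u := w), T.dist_comm (u := φ w)] at h2 h3
    have hback : φ u' ≠ u := by
      intro h
      rw [h] at hcl
      omega
    have hφu := (hφ.eq_iff u u' huu').mpr hback
    have hψu := (hψ.eq_iff u u' huu').mpr (heq ▸ hback)
    refine ⟨hφu.trans hψu.symm, ?_⟩
    rw [hφu]
    omega

/-- Two different invariant end maps would differ everywhere, so that the tree would be a line. -/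
theorem IsEndMap.eq_of_equivariant (hT : T.IsTree)
    (hdeg : ∀ v : V, 1 < (T.neighborSet v).encard) (hpend : ∀ x : Ray T, ¬ x.IsPending)
    (hM : OrbitsMeetHalfTrees ρ N) {φ ψ : V → V} (hφ : IsEndMap T φ) (hψ : IsEndMap T ψ)
    (hφN : ∀ g ∈ N, ∀ v, φ (ρ g v) = ρ g (φ v)) (hψN : ∀ g ∈ N, ∀ v, ψ (ρ g v) = ρ g (ψ v)) :
    φ = ψ := by
  by_cases h : ∃ w, φ w = ψ w
  · obtain ⟨w, hw⟩ := h
    funext v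
    obtain ⟨g, hg, hmem⟩ := hM v _ _ (hφ.adj w).symm
    have := hφ.eq_of_mem_halfTree hT hψ hw hmem
    rw [hφN g hg, hψN g hg] at this
    exact (ρ g).injective this
  · push Not at h
    obtain ⟨p, a, b, c, ha, hb, hc, hab, hac, hbc⟩ := exists_branch_vertex hT hdeg hpend
    have key : ∀ u, T.Adj p u → u = φ p ∨ u = ψ p := by
      intro u hu
      by_contra! hne
      have h1 := (hφ.eq_iff u p hu.symm).mpr hne.1.symm
      have h2 := (hψ.eq_iff u p hu.symm).mpr hne.2.symm
      exact h u (h1.trans h2.symm)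
    grind [key a ha, key b hb, key c hc]

theorem not_fixesEnd_of_normal (hT : T.IsTree)
    (hdeg : ∀ v : V, 1 < (T.neighborSet v).encard) (hpend : ∀ x : Ray T, ¬ x.IsPending)
    (hM : OrbitsMeetHalfTrees ρ N) (hE : ¬ FixesEnd ρ K)
    (hnorm : ∀ k ∈ K, ∀ n ∈ N, k * n * k⁻¹ ∈ N) : ¬ FixesEnd ρ N := by
  rintro ⟨φ, hφ, hφN⟩
  refine hE ⟨φ, hφ, fun k hk v => ?_⟩
  -- the conjugate of `φ` by `k`
  have hψ : IsEndMap T fun v => ρ k (φ (ρ k⁻¹ v)) := by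
    refine ⟨fun v => ?_, fun u v huv => ?_⟩
    · have := adj_act ρ k (hφ.adj (ρ k⁻¹ v))
      rwa [map_act_inv_act] at this
    · have hk' : ∀ x y : V, ρ k x = y ↔ x = ρ k⁻¹ y := fun x y =>
        ⟨fun h => by rw [← h, map_inv_act_act], fun h => by rw [h, map_act_inv_act]⟩
      rw [Ne, hk', hk']
      exact hφ.eq_iff _ _ (adj_act ρ _ huv)
  have heq := hφ.eq_of_equivariant hT hdeg hpend hM hψ hφN fun g hg w => by
    have h1 := hnorm k⁻¹ (K.inv_mem hk) g hg
    rw [inv_inv] at h1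
    have h2 := hφN _ h1 (ρ k⁻¹ w)
    rw [← map_mul_act, mul_assoc, mul_inv_cancel, mul_one, map_mul_act] at h2
    rw [h2, ← map_mul_act, ← map_mul_act, mul_assoc, mul_inv_cancel_left]
  have := congrFun heq (ρ k v)
  rwa [map_inv_act_act] at this

end Action

theorem proposition1p2 {V Γ : Type*} (T : SimpleGraph V) (hT : T.IsTree)
    (hdeg : ∀ v : V, 1 < (T.neighborSet v).encard)
    (hpend : ∀ x : Ray T, ¬ x.IsPending)
    [Group Γ] [Countable Γ] (ρ : Γ →* (T ≃g T))
    (hmin : IsMinimalAction ρ)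
    (hfix : ¬ HasFixedBoundaryPoint ρ)
    (hslender : IsSlenderAction ρ) :
    IsStronglyPowersGroup Γ := by
  have key : ∀ N : Subgroup Γ, N.IsSubnormal → N ≠ ⊥ →
      OrbitsMeetHalfTrees ρ N ∧ ¬ FixesEnd ρ N := by
    intro N hN
    induction hN with
    | top => exact fun _ => ⟨hmin.orbitsMeetHalfTrees hT, not_fixesEnd_top hT hfix⟩
    | step N K hle _ hnormal ih =>
      intro hbot
      obtain ⟨hM, hE⟩ := ih fun h => hbot (le_bot_iff.mp (h ▸ hle))
      have hnorm : ∀ k ∈ K, ∀ n ∈ N, k * n * k⁻¹ ∈ N := fun k hk n hn =>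
        hnormal.conj_mem ⟨n, hle hn⟩ hn ⟨k, hk⟩
      have hMN := orbitsMeetHalfTrees_of_normal hT hdeg hslender hbot hM hE hnorm
      exact ⟨hMN, not_fixesEnd_of_normal hT hdeg hpend hMN hE hnorm⟩
  intro N hN hbot
  obtain ⟨hM, hE⟩ := key N hN hbot
  exact isPowersGroup_of_orbitsMeetHalfTrees hT hdeg hpend hslender hbot hM hE
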